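/- Let $\phi:\mathbb{R}^n\to\mathbb{R}\cup\{+\infty\}$ be proper, lower semicontinuous and $m_\phi$-weakly convex for some finite $m_\phi\ge 0$ (i.e. $\phi+\frac{m_\phi}{2}\|\cdot\|^2$ is convex), let $g:\mathbb{R}^n\to\mathbb{R}$ be convex, and suppose that $F:=\phi-g$ attains its minimum over $\mathbb{R}^n$. Let $0<\mu<1/m_\phi$ (with $1/0:=+\infty$) and let $$F_\mu:=M_{\mu\phi}-M_{\mu g},\qquad M_{\mu f}(z):=\min_{x\in\mathbb{R}^n}\Big\{f(x)+\frac{1}{2\mu}\|x-z\|^2\Big\},$$ where $\|\cdot\|$ is the Euclidean norm. Call a function $H:\mathbb{R}^n\to\mathbb{R}\cup\{+\infty\}$ *level-bounded* if $\{x: H(x)\le\alpha\}$ is bounded (possibly empty) for every $\alpha\in\mathbb{R}$; *level-coercive* if there exist $\alpha>0$ and $r\in\mathbb{R}$ with $H\ge\alpha\|\cdot\|+r$; and *coercive* if for every $\alpha>0$ there exists $r\in\mathbb{R}$ with $H\ge\alpha\|\cdot\|+r$. Then: 1. If $F$ is level-bounded and there exist $L>0$ and $M\ge 0$ such that $|g(x)-g(z)|\le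 L\|x-z\|+M$ for all $x,z\in\mathbb{R}^n$, then $F_\mu$ is level-bounded. 2. If $F$ is level-coercive, then $F_\mu$ is level-bounded. 3. If $\mathrm{dom}\,\phi:=\{x:\phi(x)<+\infty\}$ is compact, then $F_\mu$ is coercive, and therefore level-bounded. 4. If $F$ is level-bounded and $\mathrm{dom}\,\phi=\mathbb{R}^n$, then $F_\mu$ is level-bounded. -/

import Mathlib

namespace DME

/-- The Euclidean space `ℝⁿ`. -/
abbrev Rn (n : ℕ) : Type := EuclideanSpace ℝ (Fin n)

/-- Properness of an extended-real-valued function: it never takes the value `-∞`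
and is not identically `+∞`. -/
def IsProper {n : ℕ} (f : Rn n → EReal) : Prop :=
  (∀ x, f x ≠ ⊥) ∧ ∃ x, f x ≠ ⊤

/-- The effective domain of an extended-real-valued function. -/
def effDom {n : ℕ} (f : Rn n → EReal) : Set (Rn n) :=
  {x | f x < ⊤}

/-- Convexity of an extended-real-valued function (which is meant to avoid the value `-∞`):
Jensen's inequality for two points. -/
def IsConvex {n : ℕ} (f : Rn n → EReal) : Prop :=
  ∀ (x y : Rn n) (a b : ℝ), 0 < a → 0 < b → a + b = 1 →
    f (a • x + b • y) ≤ (a : EReal) * f x + (b : EReal) * f y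

/-- `f` is `m`-weakly convex: `f + (m / 2) ‖·‖²` is convex. -/
def IsWeaklyConvex {n : ℕ} (m : ℝ) (f : Rn n → EReal) : Prop :=
  IsConvex fun x => f x + ((m / 2 * ‖x‖ ^ 2 : ℝ) : EReal)

/-- The Moreau envelope `M_{μ f}(z) = inf_x { f x + ‖x - z‖² / (2 μ) }`, as an extended real. -/
noncomputable def moreauEnvelope {n : ℕ} (μ : ℝ) (f : Rn n → EReal) (z : Rn n) : EReal :=
  ⨅ x : Rn n, f x + ((1 / (2 * μ) * ‖x - z‖ ^ 2 : ℝ) : EReal)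

/-- The difference function `F = φ - g` with `g` finite-valued. -/
noncomputable def dcFun {n : ℕ} (φ : Rn n → EReal) (g : Rn n → ℝ) (x : Rn n) : EReal :=
  φ x - (g x : EReal)

/-- The difference-of-Moreau-envelopes smoothing `F_μ = M_{μ φ} - M_{μ g}`. -/
noncomputable def smoothing {n : ℕ} (μ : ℝ) (φ : Rn n → EReal) (g : Rn n → ℝ) (z : Rn n) :
    EReal :=
  moreauEnvelope μ φ z - moreauEnvelope μ (fun x => (g x : EReal)) z

/-- All lower level sets at real levels are bounded (possibly empty). -/
def IsLevelBounded {n : ℕ} (f : Rn n → EReal) : Prop :=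
  ∀ α : ℝ, Bornology.IsBounded {x | f x ≤ (α : EReal)}

/-- `f ≥ α ‖·‖ + r` for some `α > 0` and some real `r`. -/
def IsLevelCoercive {n : ℕ} (f : Rn n → EReal) : Prop :=
  ∃ α : ℝ, 0 < α ∧ ∃ r : ℝ, ∀ x, ((α * ‖x‖ + r : ℝ) : EReal) ≤ f x

/-- For every `α > 0` there is a real `r` with `f ≥ α ‖·‖ + r`. -/
def IsCoercive {n : ℕ} (f : Rn n → EReal) : Prop :=
  ∀ α : ℝ, 0 < α → ∃ r : ℝ, ∀ x, ((α * ‖x‖ + r : ℝ) : EReal) ≤ f x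

/-- `g` is Lipschitz up to an additive constant. -/
def IsLipschitzUpToConst {n : ℕ} (g : Rn n → ℝ) : Prop :=
  ∃ L : ℝ, 0 < L ∧ ∃ M : ℝ, 0 ≤ M ∧ ∀ x z, ‖g x - g z‖ ≤ L * ‖x - z‖ + M

end DME

/-!
Write `q(v) = ‖v‖² / (2μ)`. For `x` in a ball of radius `R`, move from `x` towards `z` by the fixed
length `μα`, reaching a point `y`. The quadratic term drops by about `α‖x - z‖`, while
`g y - g x` stays bounded because `g` is continuous and `x`, `y` stay in a fixed ball. As
`M_{μg}(z) ≤ g y + q(y - z)` and `φ - g ≥ c`, this gives, uniformly in `z`,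
`M_{μg}(z) + α‖z‖ + r ≤ φ x + q(x - z)` for all `x` in the ball
(`DME.exists_le_add_quadratic`).

If `dom φ` is bounded, the infimum over `x` of this bound says that `F_μ` is coercive
(`DME.isCoercive_smoothing`). If `F` is only level-bounded and `F_μ z ≤ a`, choose `x` with
`φ x + q(x - z) < M_{μg}(z) + a + 1`; since `M_{μg}(z) ≤ g x + q(x - z)`, this `x` lies in the
level set `{F ≤ a + 1}`, which is bounded, and the bound with `α = 1` limits `‖z‖`
(`DME.isLevelBounded_smoothing`). So level-boundedness of `F` alone passes to `F_μ`, which covers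
the Lipschitz, the level-coercive and the full-domain cases together.
-/

namespace DME

variable {n : ℕ}

lemma IsLevelCoercive.isLevelBounded {f : Rn n → EReal} (h : IsLevelCoercive f) :
    IsLevelBounded f := by
  obtain ⟨α, hα, r, hr⟩ := h
  intro a
  refine isBounded_iff_forall_norm_le.2 ⟨(a - r) / α, fun x hx => ?_⟩
  have : α * ‖x‖ + r ≤ a := EReal.coe_le_coe_iff.1 ((hr x).trans hx)
  rw [le_div_iff₀ hα]
  linarith

lemma IsCoercive.isLevelBounded {f : Rn n → EReal} (h : IsCoercive f) : IsLevelBounded f :=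
  IsLevelCoercive.isLevelBounded ⟨1, one_pos, h 1 one_pos⟩

lemma moreauEnvelope_coe_le (μ : ℝ) (g : Rn n → ℝ) (y z : Rn n) :
    moreauEnvelope μ (fun x => (g x : EReal)) z
      ≤ ((g y + 1 / (2 * μ) * ‖y - z‖ ^ 2 : ℝ) : EReal) := by
  rw [EReal.coe_add]
  exact iInf_le (fun x : Rn n => (g x : EReal) + ((1 / (2 * μ) * ‖x - z‖ ^ 2 : ℝ) : EReal)) y

lemma continuous_of_convexOn_univ {g : Rn n → ℝ} (hg : ConvexOn ℝ Set.univ g) : Continuous g :=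
  continuousOn_univ.1 (hg.continuousOn isOpen_univ)

/-- The Moreau envelope of a finite convex function is finite: an affine minorant of `g` plus the
quadratic term is bounded below. -/
lemma exists_moreauEnvelope_eq_coe {μ : ℝ} (hμ : 0 < μ) {g : Rn n → ℝ}
    (hg : ConvexOn ℝ Set.univ g) (z : Rn n) :
    ∃ r : ℝ, moreauEnvelope μ (fun x => (g x : EReal)) z = (r : EReal) := by
  obtain ⟨l, c, hlc, -⟩ := hg.exists_affine_le_of_lt (𝕜 := ℝ) (Set.mem_univ z)
    (sub_one_lt (g z)) isClosed_univ
    ((continuous_of_convexOn_univ hg).lowerSemicontinuous.lowerSemicontinuousOn _)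
  have hl : ∀ x, l x + c ≤ g x := fun x => by simpa using hlc ⟨x, Set.mem_univ x⟩
  have hlow : ((l z + c - μ * ‖l‖ ^ 2 / 2 : ℝ) : EReal)
      ≤ moreauEnvelope μ (fun x => (g x : EReal)) z := by
    refine le_iInf fun x => ?_
    rw [← EReal.coe_add, EReal.coe_le_coe_iff]
    have h1 : -(‖l‖ * ‖x - z‖) ≤ l x - l z := by
      rw [← map_sub]
      exact (abs_le.1 (l.le_opNorm (x - z))).1
    -- Young's inequality, as a completed square
    have h2 : 1 / (2 * μ) * ‖x - z‖ ^ 2 - ‖l‖ * ‖x - z‖ + μ * ‖l‖ ^ 2 / 2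
        = 1 / (2 * μ) * (‖x - z‖ - μ * ‖l‖) ^ 2 := by
      field_simp
      ring
    have h3 : 0 ≤ 1 / (2 * μ) * (‖x - z‖ - μ * ‖l‖) ^ 2 := by positivity
    linarith [hl x]
  have htop : moreauEnvelope μ (fun x => (g x : EReal)) z ≠ ⊤ :=
    ((moreauEnvelope_coe_le μ g z z).trans_lt (EReal.coe_lt_top _)).ne
  have hbot : moreauEnvelope μ (fun x => (g x : EReal)) z ≠ ⊥ :=
    ((EReal.bot_lt_coe _).trans_le hlow).ne'
  exact ⟨_, (EReal.coe_toReal htop hbot).symm⟩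

/-- Moving from `x` towards `z` by a length `s` (possibly past `z`). -/
lemma exists_norm_sub_le_norm_sub_sq_le {s : ℝ} (hs : 0 ≤ s) (x z : Rn n) :
    ∃ y, ‖y - x‖ ≤ s ∧ ‖y - z‖ ^ 2 ≤ (‖x - z‖ - s) ^ 2 := by
  by_cases h : x = z
  · exact ⟨x, by simpa using hs, by simp [h, sq_nonneg]⟩
  have hD : 0 < ‖x - z‖ := norm_pos_iff.2 (sub_ne_zero.2 h)
  refine ⟨x - (s / ‖x - z‖) • (x - z), ?_, le_of_eq ?_⟩
  · have : x - (s / ‖x - z‖) • (x - z) - x = -((s / ‖x - z‖) • (x - z)) := by abel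
    rw [this, norm_neg, norm_smul, Real.norm_of_nonneg (by positivity), div_mul_cancel₀ _ hD.ne']
  · have : x - (s / ‖x - z‖) • (x - z) - z = (1 - s / ‖x - z‖) • (x - z) := by
      rw [sub_smul, one_smul]
      abel
    rw [this, norm_smul, mul_pow, Real.norm_eq_abs, sq_abs, ← mul_pow, sub_mul, one_mul,
      div_mul_cancel₀ _ hD.ne']

/-- On a bounded set of `x`, the value of the envelope at `z` lies below `g x + ‖x - z‖² / (2μ)` by
a margin growing linearly in `‖z‖`, with any prescribed slope `α`. -/
lemma exists_moreauEnvelope_add_norm_le {μ : ℝ} (hμ : 0 < μ) {g : Rn n → ℝ}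
    (hg : Continuous g) (R : ℝ) {α : ℝ} (hα : 0 ≤ α) :
    ∃ C : ℝ, ∀ x z : Rn n, ‖x‖ ≤ R →
      moreauEnvelope μ (fun x => (g x : EReal)) z
        ≤ ((g x + 1 / (2 * μ) * ‖x - z‖ ^ 2 - α * ‖z‖ + C : ℝ) : EReal) := by
  have hs : 0 ≤ μ * α := by positivity
  obtain ⟨K, hK⟩ := (isCompact_closedBall (0 : Rn n) (R + μ * α)).exists_bound_of_continuousOn
    hg.continuousOn
  have hK' : ∀ v : Rn n, ‖v‖ ≤ R + μ * α → |g v| ≤ K := fun v hv =>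
    hK v (mem_closedBall_zero_iff.2 hv)
  refine ⟨2 * K + α * R + μ * α ^ 2 / 2, fun x z hx => ?_⟩
  obtain ⟨y, hyx, hyz⟩ := exists_norm_sub_le_norm_sub_sq_le hs x z
  refine (moreauEnvelope_coe_le μ g y z).trans (EReal.coe_le_coe_iff.2 ?_)
  have hy : ‖y‖ ≤ R + μ * α := by
    have := norm_add_le (y - x) x
    rw [sub_add_cancel] at this
    linarith
  have h1 := (abs_le.1 (hK' y hy)).2
  have h2 := (abs_le.1 (hK' x (by linarith))).1
  have h3 : 1 / (2 * μ) * ‖y - z‖ ^ 2 ≤ 1 / (2 * μ) * (‖x - z‖ - μ * α) ^ 2 := by gcongr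
  have h4 : 1 / (2 * μ) * (‖x - z‖ - μ * α) ^ 2
      = 1 / (2 * μ) * ‖x - z‖ ^ 2 - α * ‖x - z‖ + μ * α ^ 2 / 2 := by
    field_simp
    ring
  have h5 : α * ‖z‖ ≤ α * (‖x - z‖ + R) := by
    gcongr
    have := norm_sub_norm_le z x
    rw [norm_sub_rev] at this
    linarith
  linarith

/-- The key estimate: `α‖z‖ + r + M_{μg}(z)` minorizes the function whose infimum is `M_{μφ}(z)`,
on any ball of points `x` and uniformly in `z`. -/
lemma exists_le_add_quadratic {μ : ℝ} (hμ : 0 < μ) {φ : Rn n → EReal} {g : Rn n → ℝ}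
    (hg : Continuous g) {c : ℝ} (hc : ∀ x, (c : EReal) ≤ dcFun φ g x)
    (R : ℝ) {α : ℝ} (hα : 0 ≤ α) :
    ∃ r : ℝ, ∀ x z : Rn n, ‖x‖ ≤ R →
      ((α * ‖z‖ + r : ℝ) : EReal) + moreauEnvelope μ (fun x => (g x : EReal)) z
        ≤ φ x + ((1 / (2 * μ) * ‖x - z‖ ^ 2 : ℝ) : EReal) := by
  obtain ⟨C, hC⟩ := exists_moreauEnvelope_add_norm_le hμ hg R hα
  refine ⟨c - C, fun x z hx => ?_⟩
  have hφ : ((c + g x : ℝ) : EReal) ≤ φ x := by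
    rw [EReal.coe_add]
    exact EReal.add_le_of_le_sub (hc x)
  calc _ ≤ ((α * ‖z‖ + (c - C) : ℝ) : EReal)
        + ((g x + 1 / (2 * μ) * ‖x - z‖ ^ 2 - α * ‖z‖ + C : ℝ) : EReal) := by
        gcongr
        exact hC x z hx
    _ = ((c + g x : ℝ) : EReal) + ((1 / (2 * μ) * ‖x - z‖ ^ 2 : ℝ) : EReal) := by
        rw [← EReal.coe_add, ← EReal.coe_add]
        congr 1
        ring
    _ ≤ _ := by gcongr

/-- Near-minimizers in `M_{μφ}(z)`, for `z` in a level set of the smoothing, lie in a level set of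
`φ - g`; on that bounded set `exists_le_add_quadratic` bounds `‖z‖`. -/
lemma isLevelBounded_smoothing {μ : ℝ} (hμ : 0 < μ) {φ : Rn n → EReal} {g : Rn n → ℝ}
    (hg : ConvexOn ℝ Set.univ g) {c : ℝ} (hc : ∀ x, (c : EReal) ≤ dcFun φ g x)
    (hF : IsLevelBounded (dcFun φ g)) : IsLevelBounded (smoothing μ φ g) := by
  intro a
  obtain ⟨R, hR⟩ := isBounded_iff_forall_norm_le.1 (hF (a + 1))
  obtain ⟨r, hr⟩ := exists_le_add_quadratic hμ (continuous_of_convexOn_univ hg) hc R zero_le_one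
  refine isBounded_iff_forall_norm_le.2 ⟨a + 1 - r, fun z hz => ?_⟩
  obtain ⟨w, hw⟩ := exists_moreauEnvelope_eq_coe hμ hg z
  -- a nearly optimal `x` for the envelope of `φ` is enough; no proximal point is needed
  obtain ⟨x, hx⟩ : ∃ x, φ x + ((1 / (2 * μ) * ‖x - z‖ ^ 2 : ℝ) : EReal)
      < ((a + w + 1 : ℝ) : EReal) := by
    refine iInf_lt_iff.1 (lt_of_le_of_lt (b := ((a + w : ℝ) : EReal)) ?_
      (EReal.coe_lt_coe_iff.2 (lt_add_one _)))
    have h : moreauEnvelope μ φ z - (w : EReal) ≤ (a : EReal) := hw ▸ hz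
    rwa [EReal.sub_le_iff_le_add (.inl (EReal.coe_ne_bot w)) (.inl (EReal.coe_ne_top w)),
      ← EReal.coe_add] at h
  have hwx : w ≤ g x + 1 / (2 * μ) * ‖x - z‖ ^ 2 :=
    EReal.coe_le_coe_iff.1 (hw ▸ moreauEnvelope_coe_le μ g x z)
  have hxR : ‖x‖ ≤ R := by
    refine hR x (EReal.sub_le_of_le_add ?_)
    have h : φ x ≤ ((a + w + 1 : ℝ) : EReal) - ((1 / (2 * μ) * ‖x - z‖ ^ 2 : ℝ) : EReal) :=
      (EReal.le_sub_iff_add_le (.inl (EReal.coe_ne_bot _)) (.inl (EReal.coe_ne_top _))).2 hx.le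
    refine h.trans ?_
    rw [← EReal.coe_sub, ← EReal.coe_add, EReal.coe_le_coe_iff]
    linarith
  have h := (hr x z hxR).trans_lt hx
  rw [hw, ← EReal.coe_add, EReal.coe_lt_coe_iff] at h
  linarith

lemma isCoercive_smoothing {μ : ℝ} (hμ : 0 < μ) {φ : Rn n → EReal} {g : Rn n → ℝ}
    (hg : ConvexOn ℝ Set.univ g) {c : ℝ} (hc : ∀ x, (c : EReal) ≤ dcFun φ g x)
    (hdom : Bornology.IsBounded (effDom φ)) : IsCoercive (smoothing μ φ g) := by
  intro α hα
  obtain ⟨R, hR⟩ := isBounded_iff_forall_norm_le.1 hdom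
  obtain ⟨r, hr⟩ := exists_le_add_quadratic hμ (continuous_of_convexOn_univ hg) hc R hα.le
  refine ⟨r, fun z => ?_⟩
  obtain ⟨w, hw⟩ := exists_moreauEnvelope_eq_coe hμ hg z
  rw [smoothing, EReal.le_sub_iff_add_le (.inl (by simp [hw])) (.inl (by simp [hw]))]
  refine le_iInf fun x => ?_
  by_cases hx : x ∈ effDom φ
  · exact hr x z (hR x hx)
  · have hx' : φ x = ⊤ := not_lt_top_iff.1 hx
    rw [hx', EReal.top_add_coe]
    exact le_top

end DME

theorem proposition3 (n : ℕ) (φ : DME.Rn n → EReal) (g : DME.Rn n → ℝ) (m μ : ℝ)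
    (hφ_proper : DME.IsProper φ) (hφ_lsc : LowerSemicontinuous φ)
    (hm : 0 ≤ m) (hφ_wconv : DME.IsWeaklyConvex m φ)
    (hg : ConvexOn ℝ Set.univ g)
    (hmin : ∃ x₀, ∀ x, DME.dcFun φ g x₀ ≤ DME.dcFun φ g x)
    (hμ : 0 < μ) (hμm : μ * m < 1) :
    (DME.IsLevelBounded (DME.dcFun φ g) → DME.IsLipschitzUpToConst g →
      DME.IsLevelBounded (DME.smoothing μ φ g)) ∧
    (DME.IsLevelCoercive (DME.dcFun φ g) → DME.IsLevelBounded (DME.smoothing μ φ g)) ∧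
    (IsCompact (DME.effDom φ) →
      DME.IsCoercive (DME.smoothing μ φ g) ∧ DME.IsLevelBounded (DME.smoothing μ φ g)) ∧
    (DME.IsLevelBounded (DME.dcFun φ g) → DME.effDom φ = Set.univ →
      DME.IsLevelBounded (DME.smoothing μ φ g)) := by
  obtain ⟨x₀, hx₀⟩ := hmin
  obtain ⟨c, hc⟩ : ∃ c : ℝ, ∀ x, (c : EReal) ≤ DME.dcFun φ g x := by
    have hbot : DME.dcFun φ g x₀ ≠ ⊥ := by
      simp [DME.dcFun, sub_eq_add_neg, EReal.add_eq_bot_iff, hφ_proper.1 x₀]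
    obtain ⟨c, hc⟩ := EReal.lt_iff_exists_real_btwn.1 (bot_lt_iff_ne_bot.2 hbot)
    exact ⟨c, fun x => hc.2.le.trans (hx₀ x)⟩
  refine ⟨fun hF _ => DME.isLevelBounded_smoothing hμ hg hc hF,
    fun hF => DME.isLevelBounded_smoothing hμ hg hc hF.isLevelBounded, fun hdom => ?_,
    fun hF _ => DME.isLevelBounded_smoothing hμ hg hc hF⟩
  have h := DME.isCoercive_smoothing hμ hg hc hdom.isBounded
  exact ⟨h, h.isLevelBounded⟩
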